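/- **Setting.** Let $(X,\epsilon)$ and $(\widetilde X,\widetilde\epsilon)$ be random pairs in $\mathbb R^p\times\mathbb R$. Assume that the coordinates of $X$ are square integrable, centred and pairwise independent with $\mathrm{Var}(X_i)=\lambda_i$, that those of $\widetilde X$ are square integrable, centred and pairwise independent with $\mathrm{Var}(\widetilde X_i)=\widetilde\lambda_i$, that $\mathbb E[\epsilon\mid X]=0$, $\mathrm{Var}(\epsilon)=\sigma^2<\infty$, $\mathbb E[\widetilde\epsilon\mid\widetilde X]=0$, $\mathrm{Var}(\widetilde\epsilon)=\widetilde\sigma^2<\infty$, and that $\widetilde\epsilon$ is bounded. Put $\Lambda=\mathrm{diag}(\lambda_1,\dots,\lambda_p)$ and $\widetilde\Lambda=\mathrm{diag}(\widetilde\lambda_1,\dots,\widetilde\lambda_p)$. Assume that $\chi^2=\chi^2(\mathbb P_X\Vert\mathbb P_{\widetilde X})=\int\big(\tfrac{d\mathbb P_X}{d\mathbb P_{\widetilde X}}-1\big)^2d\mathbb P_{\widetilde X}$ is finite (it is $\infty$ if $\mathbb P_X\not\ll\mathbb P_{\widetilde X}$); $\mathbb P_X$ and $\mathbb P_{\widetilde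 X}$ may differ. Let $\mathcal X$ be a set that contains $X$ almost surely. Let $(x_i,\epsilon_i)_{i\ge1}$ be i.i.d. copies of $(X,\epsilon)$ and, independently of them, $(\widetilde x_i,\widetilde\epsilon_i)_{i\ge1}$ i.i.d. copies of $(\widetilde X,\widetilde\epsilon)$. Let $\mu(x)=x^T\beta^*$, $Y=\mu(X)+\epsilon$ and $y_i=x_i^T\beta^*+\epsilon_i$. Write $\mathbb X\in\mathbb R^{n\times p}$ for the matrix with rows $x_1^T,\dots,x_n^T$, $\mathbb Y=(y_1,\dots,y_n)^T$, $\boldsymbol\epsilon=(\epsilon_1,\dots,\epsilon_n)^T$, $\widehat\beta=(\mathbb X^T\mathbb X)^{-1}\mathbb X^T\mathbb Y$ and $\widehat f_{LR}(x)=\widehat\mu(x)=x^T\widehat\beta$. The synthetic responses are $\widetilde y_i=\widetilde x_i^T\widehat\beta+\widetilde\epsilon_i$; with $\widetilde{\mathbb X}\in\mathbb R^{\widetilde n\times p}$, $\widetilde{\mathbb Y}$, $\widetilde{\boldsymbol\epsilon}$ formed in the same way, $\widetilde f_{LR}(x)=x^T(\widetilde{\mathbb X}^T\widetilde{\mathbb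 X})^{-1}\widetilde{\mathbb X}^T\widetilde{\mathbb Y}$. Assume that $\mathbb X^T\mathbb X$ is almost surely invertible for all $n\ge n_0$ and $\widetilde{\mathbb X}^T\widetilde{\mathbb X}$ for all $\widetilde n\ge\widetilde n_0$. Let $\mathbb Q=\mathbb X(\mathbb X^T\mathbb X)^{-1}$, $\widetilde{\mathbb Q}=\widetilde{\mathbb X}(\widetilde{\mathbb X}^T\widetilde{\mathbb X})^{-1}$ and $$M_{LR}=\max\Big\{\sup_{x\in\mathcal X}|x^T\mathbb Q^T\mathbb Y|,\ \sup_{x\in\mathcal X}|x^T\widetilde{\mathbb Q}^T\widetilde{\mathbb Y}|\Big\}\in[0,\infty].$$ For $f:\mathbb R^p\to\mathbb R$ let $R_s(f)=\mathbb E[(f(X)-Y)^2]$, $\Phi_s(f)=\mathbb E[(f(X)-\mu(X))^2]$, and, with the samples held fixed and $(\widetilde X,\widetilde\epsilon)$ a fresh pair, $\widetilde R_s(f)=\mathbb E[(f(\widetilde X)-\widehat\mu(\widetilde X)-\widetilde\epsilon)^2]$ and $\widetilde\Phi_s(f)=\mathbb E[(f(\widetilde X)-\widehat\mu(\widetilde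 X))^2]$. Let $U_r(f,g)=|R_s(f)-R_s(g)|$. **Theorem.** (i) For all $n\ge n_0$ and $\widetilde n\ge\widetilde n_0$, almost surely $U_r(\widetilde f_{LR},\widehat f_{LR})\le B$, where (with $0\cdot\infty=0$) $$\begin{aligned}B={}&13\,\mathrm{trace}\big(\boldsymbol\epsilon\boldsymbol\epsilon^T\mathbb Q\Lambda\mathbb Q^T\big)+\mathrm{trace}\big(\widetilde{\boldsymbol\epsilon}\widetilde{\boldsymbol\epsilon}^T\widetilde{\mathbb Q}\widetilde\Lambda\widetilde{\mathbb Q}^T\big)\\&+2M_{LR}\sqrt{\chi^2}\,\Big\{\sqrt{\mathrm{trace}\big(\widetilde{\boldsymbol\epsilon}\widetilde{\boldsymbol\epsilon}^T\widetilde{\mathbb Q}\widetilde\Lambda\widetilde{\mathbb Q}^T\big)}+\sqrt{\mathrm{trace}\big(\boldsymbol\epsilon\boldsymbol\epsilon^T\mathbb Q\widetilde\Lambda\mathbb Q^T\big)}\Big\}\\&+2\sqrt{2\,\mathrm{trace}\big(\widetilde{\boldsymbol\epsilon}\widetilde{\boldsymbol\epsilon}^T\widetilde{\mathbb Q}\Lambda\widetilde{\mathbb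 Q}^T\big)}\sqrt{\mathrm{trace}\big(\boldsymbol\epsilon\boldsymbol\epsilon^T\mathbb Q\Lambda\mathbb Q^T\big)}.\end{aligned}$$ Moreover, almost surely, $B$ is obtained from the general utility bound: if $f^*$ minimizes $R_s$ and $\widetilde f^*$ minimizes $\widetilde\Phi_s$ over the linear functions $x\mapsto x^T\beta$, and if $\Upsilon_1=\sqrt{\widetilde\Phi_s(\widetilde f_{LR})}+2\sqrt{\widetilde\Phi_s(\widetilde f^*)}+\sqrt{\widetilde\Phi_s(f^*)}$ and $\Upsilon_2=\sqrt{\Phi_s(\widetilde f_{LR})}+2\sqrt{\Phi_s(\widetilde f^*)}+\sqrt{\Phi_s(f^*)}$, then $$U_r(\widetilde f_{LR},\widehat f_{LR})\le|R_s(\widehat f_{LR})-R_s(f^*)|+|\widetilde R_s(\widetilde f_{LR})-\widetilde R_s(\widetilde f^*)|+2M_{LR}\Upsilon_1\sqrt{\chi^2}+2\Upsilon_2\sqrt{\Phi_s(\widehat\mu)}+4\Phi_s(\widehat\mu)\le B.$$ (ii) For every $\delta>0$, $$\lim_{n\to\infty}\lim_{\widetilde n\to\infty}\mathbb P\big(U_r(\widetilde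 f_{LR},\widehat f_{LR})>\delta\big)=0,$$ where the inner limit exists for every $n\ge n_0$ and the randomness comes from $\boldsymbol\epsilon,\widetilde{\boldsymbol\epsilon},\mathbb X,\widetilde{\mathbb X}$. -/

import Mathlib

open MeasureTheory ProbabilityTheory Filter Topology
open scoped ENNReal Matrix

noncomputable section

namespace SyntheticLR

/-- The chi-squared divergence `χ²(P ‖ Q) = ∫ (dP/dQ - 1)² dQ`, equal to `∞` unless `P ≪ Q`. -/
def chiSqDiv {E : Type*} [MeasurableSpace E] (P Q : Measure E) : ℝ≥0∞ :=
  open Classical in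
  if P ≪ Q then ∫⁻ x, ENNReal.ofReal (((P.rnDeriv Q x).toReal - 1) ^ 2) ∂Q else ⊤

/-- The squared-loss risk `E[(f(X) - Y)²]`, where `PXY` is the law of `(X, Y)`. -/
def risk {E : Type*} [MeasurableSpace E] (PXY : Measure (E × ℝ)) (f : E → ℝ) : ℝ :=
  ∫ q, (f q.1 - q.2) ^ 2 ∂PXY

/-- The excess risk `E[(f(X) - g(X))²]` relative to the regression function `g`,
where `PX` is the law of `X`. -/
def excessRisk {E : Type*} [MeasurableSpace E] (PX : Measure E) (g f : E → ℝ) : ℝ :=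
  ∫ x, (f x - g x) ^ 2 ∂PX

/-- The utility metric `|R(f) - R(g)|`. -/
def utility {E : Type*} [MeasurableSpace E] (PXY : Measure (E × ℝ)) (f g : E → ℝ) : ℝ :=
  |risk PXY f - risk PXY g|

/-- `f` is an optimal element of the class `F` for the objective `R`. -/
def IsOptimal {E : Type*} (F : Set (E → ℝ)) (R : (E → ℝ) → ℝ) (f : E → ℝ) : Prop :=
  f ∈ F ∧ ∀ g ∈ F, R f ≤ R g

/-- The general utility bound for regression. `PXY` and `PXYt` are the original and the synthetic
law of features and responses, `μ` and `μhat` the original and the synthetic regression function,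
`fhat` and `ft` the models trained on the original and on the synthetic data, `fs` and `fts` the
optimal functions in the class under the two laws, and `M` the uniform bound. -/
def regressionUtilityBound {E : Type*} [MeasurableSpace E] (PXY PXYt : Measure (E × ℝ))
    (μ μhat fhat ft fs fts : E → ℝ) (M : ℝ≥0∞) : ℝ≥0∞ :=
  let Φ := excessRisk PXY.fst μ
  let Φt := excessRisk PXYt.fst μhat
  let Υ₁ : ℝ := √(Φt ft) + 2 * √(Φt fts) + √(Φt fs)
  let Υ₂ : ℝ := √(Φ ft) + 2 * √(Φ fts) + √(Φ fs)
  ENNReal.ofReal |risk PXY fhat - risk PXY fs|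
    + ENNReal.ofReal |risk PXYt ft - risk PXYt fts|
    + 2 * M * ENNReal.ofReal Υ₁ * chiSqDiv PXY.fst PXYt.fst ^ (1 / 2 : ℝ)
    + ENNReal.ofReal (2 * Υ₂ * √(Φ μhat))
    + ENNReal.ofReal (4 * Φ μhat)

/-- `ν` is the law of a pair (feature vector, noise): the features are square integrable, centred
and pairwise independent, the `i`-th one with variance `lam i`, and the noise has variance `σ ^ 2`
and conditional mean zero given the features. -/
structure IsFeatureNoiseLaw {p : ℕ} (ν : Measure ((Fin p → ℝ) × ℝ)) (lam : Fin p → ℝ) (σ : ℝ) :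
    Prop where
  memLp_feature : ∀ i, MemLp (fun q => q.1 i) 2 ν
  mean_feature : ∀ i, ∫ q, q.1 i ∂ν = 0
  var_feature : ∀ i, Var[fun q => q.1 i; ν] = lam i
  indep_feature : ∀ i j, i ≠ j → IndepFun (fun q => q.1 i) (fun q => q.1 j) ν
  memLp_noise : MemLp (fun q => q.2) 2 ν
  condMean_noise :
    ν[fun q => q.2 | MeasurableSpace.comap Prod.fst inferInstance] =ᵐ[ν] fun _ => (0 : ℝ)
  var_noise : Var[fun q => q.2; ν] = σ ^ 2

/-- The linear function `x ↦ xᵀ β`. -/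
def lin {p : ℕ} (β : Fin p → ℝ) : (Fin p → ℝ) → ℝ := fun x => x ⬝ᵥ β

/-- The class of all linear functions. -/
def linClass (p : ℕ) : Set ((Fin p → ℝ) → ℝ) := Set.range lin

/-- The law of `(X, Xᵀ β + e)` when `(X, e)` has law `ν`. -/
def responseLaw {p : ℕ} (β : Fin p → ℝ) (ν : Measure ((Fin p → ℝ) × ℝ)) :
    Measure ((Fin p → ℝ) × ℝ) :=
  ν.map fun q => (q.1, lin β q.1 + q.2)

/-- The design matrix whose rows are the first `n` feature vectors. -/
def design {p : ℕ} (n : ℕ) (x : ℕ → Fin p → ℝ) : Matrix (Fin n) (Fin p) ℝ :=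
  Matrix.of fun i j => x i j

/-- The vector of the first `n` noise terms. -/
def noise (n : ℕ) (e : ℕ → ℝ) : Fin n → ℝ := fun i => e i

/-- The vector of the responses `yᵢ = xᵢᵀ β + eᵢ`, `i < n`. -/
def responses {p : ℕ} (n : ℕ) (β : Fin p → ℝ) (x : ℕ → Fin p → ℝ) (e : ℕ → ℝ) : Fin n → ℝ :=
  design n x *ᵥ β + noise n e

/-- The ordinary least squares coefficient vector `(AᵀA)⁻¹ Aᵀ Y`. -/
def ols {n p : ℕ} (A : Matrix (Fin n) (Fin p) ℝ) (Y : Fin n → ℝ) : Fin p → ℝ :=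
  ((Aᵀ * A)⁻¹ * Aᵀ) *ᵥ Y

/-- The least squares coefficients fitted on the original data of size `n`. -/
def betaHat {p : ℕ} (n : ℕ) (βs : Fin p → ℝ) (x : ℕ → Fin p → ℝ) (e : ℕ → ℝ) : Fin p → ℝ :=
  ols (design n x) (responses n βs x e)

/-- The least squares coefficients fitted on the synthetic data of size `m`, whose responses are
generated from the original least squares fit. -/
def betaTilde {p : ℕ} (n m : ℕ) (βs : Fin p → ℝ) (x : ℕ → Fin p → ℝ) (e : ℕ → ℝ)
    (xt : ℕ → Fin p → ℝ) (et : ℕ → ℝ) : Fin p → ℝ :=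
  ols (design m xt) (responses m (betaHat n βs x e) xt et)

/-- The matrix `Q = A (AᵀA)⁻¹`. -/
def qMat {n p : ℕ} (A : Matrix (Fin n) (Fin p) ℝ) : Matrix (Fin n) (Fin p) ℝ :=
  A * (Aᵀ * A)⁻¹

/-- `trace (e eᵀ Q Λ Qᵀ)` with `Λ = diag(lam)`. -/
def quadTrace {n p : ℕ} (e : Fin n → ℝ) (Q : Matrix (Fin n) (Fin p) ℝ) (lam : Fin p → ℝ) : ℝ :=
  (Matrix.vecMulVec e e * Q * Matrix.diagonal lam * Qᵀ).trace

/-- `max (sup_{z ∈ S} |zᵀ Qᵀ Y|) (sup_{z ∈ S} |zᵀ Q̃ᵀ Ỹ|)`, with values in `[0, ∞]`. -/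
def supBound {n m p : ℕ} (S : Set (Fin p → ℝ)) (Q : Matrix (Fin n) (Fin p) ℝ) (Y : Fin n → ℝ)
    (Qt : Matrix (Fin m) (Fin p) ℝ) (Yt : Fin m → ℝ) : ℝ≥0∞ :=
  max (⨆ z ∈ S, ENNReal.ofReal |z ⬝ᵥ (Qᵀ *ᵥ Y)|) (⨆ z ∈ S, ENNReal.ofReal |z ⬝ᵥ (Qtᵀ *ᵥ Yt)|)

/-- The explicit trace form of the utility bound; `χ` is the chi-squared divergence and `M` the
uniform bound (with `0 * ∞ = 0`). -/
def traceBound {n m p : ℕ} (e : Fin n → ℝ) (Q : Matrix (Fin n) (Fin p) ℝ)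
    (et : Fin m → ℝ) (Qt : Matrix (Fin m) (Fin p) ℝ) (lam lamt : Fin p → ℝ) (χ M : ℝ≥0∞) : ℝ≥0∞ :=
  ENNReal.ofReal (13 * quadTrace e Q lam) + ENNReal.ofReal (quadTrace et Qt lamt)
    + 2 * M * χ ^ (1 / 2 : ℝ)
        * ENNReal.ofReal (√(quadTrace et Qt lamt) + √(quadTrace e Q lamt))
    + ENNReal.ofReal (2 * √(2 * quadTrace et Qt lam) * √(quadTrace e Q lam))

end SyntheticLR

end

/-! Part (i). Both regressions are well specified, so each excess risk is a squared `L²` distance to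
the regression function, and the least squares errors are `β̂ - β* = Qᵀε` and `β̃ - β̂ = Q̃ᵀε̃`.
By the triangle inequality through `μ̂`, the utility is controlled by `Φ(μ̂)` and the distance from
`f̃` to `μ̂` under `P_X`. That distance is passed to the law of `X̃` by Cauchy-Schwarz against the
density defect `dP_X/dP_X̃ - 1`, whose `L²` norm is `√χ²`, together with `|f̃ - μ̂| ≤ 2M`. Every
remaining term is a quadratic form in a least squares error, that is, one of the traces.

Part (ii). For fixed `n`, the strong law of large numbers makes the synthetic Gram matrix and the
design-noise products, divided by the sample size, converge to `Λ̃` and `0` respectively. As `Λ̃` is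
invertible, `β̃ → β̂` almost surely, and the risk is a continuous function of the coefficients.
Hence every inner limit is `0`. -/

namespace SyntheticLR

section RealInequalities

lemma abs_sq_sub_sq_le {s a b : ℝ} (hs : 0 ≤ s) (h : s ≤ a + b) :
    |s ^ 2 - a ^ 2| ≤ a ^ 2 + b ^ 2 + 2 * (s + 2 * a) * a := by
  rw [abs_le]
  constructor
  · nlinarith [sq_nonneg (s + a), sq_nonneg a, sq_nonneg b]
  · nlinarith [sq_nonneg (s - b), mul_le_mul_of_nonneg_left h hs, sq_nonneg a]

lemma sq_add_two_mul_add_four_mul_sq_le {s a b : ℝ} (ha : 0 ≤ a) (h : s ≤ a + b) :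
    a ^ 2 + 2 * (s + 2 * a) * a + 4 * a ^ 2 ≤ 13 * a ^ 2 + 2 * b * a := by
  nlinarith [mul_le_mul_of_nonneg_right h ha, sq_nonneg a]

end RealInequalities

section ExcessRisk

variable {E : Type*} [MeasurableSpace E] {P : Measure E} {f g h : E → ℝ}

lemma excessRisk_nonneg (P : Measure E) (g f : E → ℝ) : 0 ≤ excessRisk P g f :=
  integral_nonneg fun _ => sq_nonneg _

lemma excessRisk_self (P : Measure E) (g : E → ℝ) : excessRisk P g g = 0 := by
  simp [excessRisk]

lemma excessRisk_comm (P : Measure E) (g f : E → ℝ) : excessRisk P g f = excessRisk P f g :=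
  integral_congr_ae (ae_of_all _ fun _ => sub_sq_comm _ _)

lemma sqrt_excessRisk_eq_lpNorm (hf : MemLp f 2 P) (hg : MemLp g 2 P) :
    √(excessRisk P g f) = lpNorm (f - g) 2 P := by
  rw [lpNorm_eq_integral_norm_rpow_toReal two_ne_zero ENNReal.ofNat_ne_top
    (hf.sub hg).aestronglyMeasurable, Real.sqrt_eq_rpow]
  simp [excessRisk]

lemma excessRisk_eq_zero_iff (hf : MemLp f 2 P) (hg : MemLp g 2 P) :
    excessRisk P g f = 0 ↔ f =ᵐ[P] g := by
  rw [← Real.sqrt_eq_zero (excessRisk_nonneg P g f), sqrt_excessRisk_eq_lpNorm hf hg,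
    lpNorm_eq_zero (hf.sub hg) two_ne_zero, sub_ae_eq_zero]

lemma sqrt_excessRisk_le_add (hf : MemLp f 2 P) (hg : MemLp g 2 P) (hh : MemLp h 2 P) :
    √(excessRisk P g f) ≤ √(excessRisk P g h) + √(excessRisk P h f) := by
  rw [sqrt_excessRisk_eq_lpNorm hf hg, sqrt_excessRisk_eq_lpNorm hh hg,
    sqrt_excessRisk_eq_lpNorm hf hh, add_comm]
  exact lpNorm_sub_le_lpNorm_sub_add_lpNorm_sub hf hh one_le_two

end ExcessRisk

section ChangeOfMeasure

variable {E : Type*} [MeasurableSpace E] {P Q : Measure E} {g : E → ℝ}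

lemma absolutelyContinuous_of_chiSqDiv_ne_top (h : chiSqDiv P Q ≠ ⊤) : P ≪ Q := by
  by_contra hac
  exact h (if_neg hac)

lemma chiSqDiv_of_ac (hac : P ≪ Q) :
    chiSqDiv P Q = ∫⁻ x, ENNReal.ofReal (((P.rnDeriv Q x).toReal - 1) ^ 2) ∂Q :=
  if_pos hac

lemma measurable_rnDeriv_sub_one (P Q : Measure E) :
    Measurable fun x => (P.rnDeriv Q x).toReal - 1 :=
  (Measure.measurable_rnDeriv P Q).ennreal_toReal.sub_const 1

lemma integral_rnDeriv_sub_one_sq (hac : P ≪ Q) :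
    ∫ x, ((P.rnDeriv Q x).toReal - 1) ^ 2 ∂Q = (chiSqDiv P Q).toReal := by
  rw [chiSqDiv_of_ac hac]
  exact integral_eq_lintegral_of_nonneg_ae (ae_of_all _ fun _ => sq_nonneg _)
    ((measurable_rnDeriv_sub_one P Q).pow_const 2).aestronglyMeasurable

lemma memLp_rnDeriv_sub_one (hχ : chiSqDiv P Q ≠ ⊤) :
    MemLp (fun x => (P.rnDeriv Q x).toReal - 1) 2 Q := by
  have hmeas := measurable_rnDeriv_sub_one P Q
  rw [memLp_two_iff_integrable_sq hmeas.aestronglyMeasurable]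
  refine ⟨(hmeas.pow_const 2).aestronglyMeasurable, ?_⟩
  rw [hasFiniteIntegral_iff_ofReal (ae_of_all _ fun _ => sq_nonneg _),
    ← chiSqDiv_of_ac (absolutelyContinuous_of_chiSqDiv_ne_top hχ)]
  exact hχ.lt_top

lemma integral_abs_mul_abs_le {f : E → ℝ} (hf : MemLp f 2 Q) (hg : MemLp g 2 Q) :
    ∫ x, |f x| * |g x| ∂Q ≤ √(∫ x, f x ^ 2 ∂Q) * √(∫ x, g x ^ 2 ∂Q) := by
  have h := integral_mul_norm_le_Lp_mul_Lq (μ := Q) (f := f) (g := g)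
    Real.HolderConjugate.two_two (by simpa using hf) (by simpa using hg)
  simpa [Real.sqrt_eq_rpow] using h

variable [SigmaFinite P] [SigmaFinite Q]

lemma eq_of_chiSqDiv_eq_zero (hχ : chiSqDiv P Q = 0) : P = Q := by
  have hac : P ≪ Q := absolutelyContinuous_of_chiSqDiv_ne_top (hχ ▸ ENNReal.zero_ne_top)
  rw [chiSqDiv_of_ac hac, lintegral_eq_zero_iff
    ((measurable_rnDeriv_sub_one P Q).pow_const 2).ennreal_ofReal] at hχ
  rw [← Measure.rnDeriv_eq_one_iff_eq hac]
  filter_upwards [hχ] with x hx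
  have hsq : ((P.rnDeriv Q x).toReal - 1) ^ 2 = 0 :=
    le_antisymm (ENNReal.ofReal_eq_zero.1 hx) (sq_nonneg _)
  exact (ENNReal.toReal_eq_one_iff _).1 (sub_eq_zero.1 (sq_eq_zero_iff.1 hsq))

-- With `r = dP/dQ`: `r g² = g² + (r - 1) g²`, and `|(r - 1) g²| ≤ K |r - 1| |g|` wherever `r ≠ 0`.
lemma integral_sq_le_add_of_chiSqDiv_ne_top (hχ : chiSqDiv P Q ≠ ⊤) (hg : MemLp g 2 Q) {K : ℝ}
    (hK : 0 ≤ K) (hgK : ∀ᵐ x ∂P, |g x| ≤ K) :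
    ∫ x, g x ^ 2 ∂P
      ≤ ∫ x, g x ^ 2 ∂Q + K * (√(chiSqDiv P Q).toReal * √(∫ x, g x ^ 2 ∂Q)) := by
  have hac := absolutelyContinuous_of_chiSqDiv_ne_top hχ
  have hr := memLp_rnDeriv_sub_one hχ
  set r : E → ℝ := fun x => (P.rnDeriv Q x).toReal with hr_def
  have hint : Integrable (fun x => |r x - 1| * |g x|) Q := hr.abs.integrable_mul hg.abs
  have hpt : ∀ᵐ x ∂Q, r x * g x ^ 2 ≤ g x ^ 2 + K * (|r x - 1| * |g x|) := by
    filter_upwards [Measure.ae_rnDeriv_ne_zero_imp_of_ae Q hgK] with x hx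
    obtain hr0 | hr0 := eq_or_ne (P.rnDeriv Q x) 0
    · simp only [hr_def, hr0, ENNReal.toReal_zero, zero_mul]
      positivity
    · have : (r x - 1) * g x ^ 2 ≤ K * (|r x - 1| * |g x|) := calc
        (r x - 1) * g x ^ 2 ≤ |r x - 1| * g x ^ 2 := by gcongr; exact le_abs_self _
        _ = |g x| * (|r x - 1| * |g x|) := by rw [← sq_abs (g x)]; ring
        _ ≤ K * (|r x - 1| * |g x|) := by gcongr; exact hx hr0
      linarith
  calc ∫ x, g x ^ 2 ∂P = ∫ x, r x * g x ^ 2 ∂Q := (integral_toReal_rnDeriv_mul hac).symm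
    _ ≤ ∫ x, g x ^ 2 + K * (|r x - 1| * |g x|) ∂Q :=
      integral_mono_of_nonneg (ae_of_all _ fun _ => by positivity)
        (hg.integrable_sq.add (hint.const_mul K)) hpt
    _ = ∫ x, g x ^ 2 ∂Q + K * ∫ x, |r x - 1| * |g x| ∂Q := by
      rw [integral_add hg.integrable_sq (hint.const_mul K), integral_const_mul]
    _ ≤ _ := by
      rw [← integral_rnDeriv_sub_one_sq hac]
      gcongr
      exact integral_abs_mul_abs_le hr hg

-- Where the right-hand side is an indeterminate `0 * ∞`, the left-hand side vanishes.
lemma ofReal_integral_sq_le_add (hg : MemLp g 2 Q) (hac : g =ᵐ[Q] 0 → g =ᵐ[P] 0) {K : ℝ≥0∞}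
    (hgK : ∀ᵐ x ∂P, ENNReal.ofReal |g x| ≤ K) :
    ENNReal.ofReal (∫ x, g x ^ 2 ∂P) ≤ ENNReal.ofReal (∫ x, g x ^ 2 ∂Q)
      + K * ENNReal.ofReal √(∫ x, g x ^ 2 ∂Q) * chiSqDiv P Q ^ (1 / 2 : ℝ) := by
  have hzero (h : g =ᵐ[P] 0) : ∫ x, g x ^ 2 ∂P = 0 :=
    integral_eq_zero_of_ae (h.mono fun x hx => by simp [hx])
  obtain hχ0 | hχ0 := eq_or_ne (chiSqDiv P Q) 0
  · simp [eq_of_chiSqDiv_eq_zero hχ0]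
  obtain hQ0 | hQ0 := eq_or_ne (∫ x, g x ^ 2 ∂Q) 0
  · have hgQ : g =ᵐ[Q] 0 := by
      rw [integral_eq_zero_iff_of_nonneg (fun x => sq_nonneg _) hg.integrable_sq] at hQ0
      exact hQ0.mono fun x hx => sq_eq_zero_iff.1 hx
    simp [hzero (hac hgQ)]
  obtain rfl | hK0 := eq_or_ne K 0
  · have hgP : g =ᵐ[P] 0 := hgK.mono fun x hx => by simpa using hx
    simp [hzero hgP]
  have hpos : 0 < √(∫ x, g x ^ 2 ∂Q) :=
    Real.sqrt_pos.2 ((integral_nonneg fun _ => sq_nonneg _).lt_of_ne' hQ0)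
  obtain rfl | hKtop := eq_or_ne K ⊤
  · simp [ENNReal.top_mul, hpos, hχ0]
  obtain hχ | hχ := eq_or_ne (chiSqDiv P Q) ⊤
  · simp [hχ, ENNReal.mul_top, hK0, hpos]
  have hreal := integral_sq_le_add_of_chiSqDiv_ne_top hχ hg ENNReal.toReal_nonneg
    (hgK.mono fun x hx => (ENNReal.ofReal_le_iff_le_toReal hKtop).1 hx)
  refine (ENNReal.ofReal_le_ofReal hreal).trans_eq ?_
  rw [ENNReal.ofReal_add (integral_nonneg fun _ => sq_nonneg _) (by positivity),
    ENNReal.ofReal_mul ENNReal.toReal_nonneg, ENNReal.ofReal_toReal hKtop,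
    ENNReal.ofReal_mul (Real.sqrt_nonneg _), Real.sqrt_eq_rpow (chiSqDiv P Q).toReal,
    ENNReal.toReal_rpow, ENNReal.ofReal_toReal (by simp [hχ]), mul_assoc, mul_comm (_ ^ _)]

end ChangeOfMeasure

section WellSpecified

variable {E : Type*} [MeasurableSpace E] {PXY PXYt : Measure (E × ℝ)} {F : Set (E → ℝ)}
  {μ μhat f g : E → ℝ}

/-- `μ` is the regression function of the law `PXY` of `(X, Y)` as seen by the well-specified square
integrable class `F`. The condition `E[Y | X] = μ(X)` is encoded by the consequence it has for `F`:
the excess risk over `μ` is the squared `L²` distance to `μ`. -/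
structure IsRegressionFunction (PXY : Measure (E × ℝ)) (F : Set (E → ℝ)) (μ : E → ℝ) : Prop where
  mem : μ ∈ F
  memLp : ∀ f ∈ F, MemLp f 2 PXY.fst
  risk_sub_risk : ∀ f ∈ F, risk PXY f - risk PXY μ = excessRisk PXY.fst μ f

lemma isOptimal_excessRisk_iff {P : Measure E} (hg : g ∈ F) :
    IsOptimal F (excessRisk P g) f ↔ f ∈ F ∧ excessRisk P g f = 0 := by
  refine and_congr_right fun _ => ⟨fun h => ?_, fun h k _ => h ▸ excessRisk_nonneg P g k⟩
  exact le_antisymm ((h g hg).trans_eq (excessRisk_self P g)) (excessRisk_nonneg P g f)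

namespace IsRegressionFunction

lemma isOptimal_risk_iff (h : IsRegressionFunction PXY F μ) :
    IsOptimal F (risk PXY) f ↔ IsOptimal F (excessRisk PXY.fst μ) f := by
  refine and_congr_right fun hf => forall₂_congr fun g hg => ?_
  rw [← h.risk_sub_risk f hf, ← h.risk_sub_risk g hg, sub_le_sub_iff_right]

lemma utility_eq (h : IsRegressionFunction PXY F μ) (hf : f ∈ F) (hg : g ∈ F) :
    utility PXY f g = |excessRisk PXY.fst μ f - excessRisk PXY.fst μ g| := by
  rw [utility, ← h.risk_sub_risk f hf, ← h.risk_sub_risk g hg, sub_sub_sub_cancel_right]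

lemma regressionUtilityBound_eq (h : IsRegressionFunction PXY F μ)
    (ht : IsRegressionFunction PXYt F μhat) (hf : f ∈ F) (M : ℝ≥0∞) :
    regressionUtilityBound PXY PXYt μ μhat μhat f μ μhat M
      = ENNReal.ofReal (excessRisk PXY.fst μ μhat) + ENNReal.ofReal (excessRisk PXYt.fst μhat f)
        + 2 * M * ENNReal.ofReal (√(excessRisk PXYt.fst μhat f) + √(excessRisk PXYt.fst μhat μ))
            * chiSqDiv PXY.fst PXYt.fst ^ (1 / 2 : ℝ)
        + ENNReal.ofReal (2 * (√(excessRisk PXY.fst μ f) + 2 * √(excessRisk PXY.fst μ μhat))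
            * √(excessRisk PXY.fst μ μhat))
        + ENNReal.ofReal (4 * excessRisk PXY.fst μ μhat) := by
  simp only [regressionUtilityBound, h.risk_sub_risk μhat ht.mem, ht.risk_sub_risk f hf,
    abs_of_nonneg (excessRisk_nonneg _ _ _), excessRisk_self, Real.sqrt_zero, mul_zero, add_zero]

lemma sqrt_excessRisk_le_add (h : IsRegressionFunction PXY F μ) (hf : f ∈ F) (hg : g ∈ F) :
    √(excessRisk PXY.fst μ f) ≤ √(excessRisk PXY.fst μ g) + √(excessRisk PXY.fst g f) :=
  SyntheticLR.sqrt_excessRisk_le_add (h.memLp f hf) (h.memLp μ h.mem) (h.memLp g hg)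

lemma ofReal_excessRisk_le_add [IsFiniteMeasure PXY] [IsFiniteMeasure PXYt]
    (ht : IsRegressionFunction PXYt F μhat) (hf : f ∈ F)
    (hac : f =ᵐ[PXYt.fst] μhat → f =ᵐ[PXY.fst] μhat) {M : ℝ≥0∞}
    (hM : ∀ᵐ z ∂PXY.fst, ENNReal.ofReal |μhat z| ≤ M ∧ ENNReal.ofReal |f z| ≤ M) :
    ENNReal.ofReal (excessRisk PXY.fst μhat f) ≤ ENNReal.ofReal (excessRisk PXYt.fst μhat f)
      + 2 * M * ENNReal.ofReal √(excessRisk PXYt.fst μhat f)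
          * chiSqDiv PXY.fst PXYt.fst ^ (1 / 2 : ℝ) := by
  refine ofReal_integral_sq_le_add (g := f - μhat) ((ht.memLp f hf).sub (ht.memLp μhat ht.mem))
    (by simpa only [sub_ae_eq_zero] using hac) (hM.mono fun z hz => ?_)
  calc ENNReal.ofReal |f z - μhat z| ≤ ENNReal.ofReal (|f z| + |μhat z|) :=
        ENNReal.ofReal_le_ofReal (abs_sub _ _)
    _ ≤ M + M := ENNReal.ofReal_add_le.trans (add_le_add hz.2 hz.1)
    _ = 2 * M := (two_mul M).symm

theorem ofReal_utility_le_regressionUtilityBound [IsFiniteMeasure PXY] [IsFiniteMeasure PXYt]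
    (h : IsRegressionFunction PXY F μ) (ht : IsRegressionFunction PXYt F μhat) (hf : f ∈ F)
    (hac : f =ᵐ[PXYt.fst] μhat → f =ᵐ[PXY.fst] μhat) {M : ℝ≥0∞}
    (hM : ∀ᵐ z ∂PXY.fst, ENNReal.ofReal |μhat z| ≤ M ∧ ENNReal.ofReal |f z| ≤ M) :
    ENNReal.ofReal (utility PXY f μhat)
      ≤ regressionUtilityBound PXY PXYt μ μhat μhat f μ μhat M := by
  have hreal : utility PXY f μhat ≤ excessRisk PXY.fst μ μhat + excessRisk PXY.fst μhat f
      + 2 * (√(excessRisk PXY.fst μ f) + 2 * √(excessRisk PXY.fst μ μhat))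
        * √(excessRisk PXY.fst μ μhat) := by
    have := abs_sq_sub_sq_le (Real.sqrt_nonneg _)
      (h.sqrt_excessRisk_le_add hf ht.mem)
    simpa only [h.utility_eq hf ht.mem, Real.sq_sqrt (excessRisk_nonneg _ _ _)] using this
  have hchange := ht.ofReal_excessRisk_le_add hf hac hM
  rw [h.regressionUtilityBound_eq ht hf]
  refine (ENNReal.ofReal_le_ofReal hreal).trans (le_add_right ?_)
  refine ENNReal.ofReal_add_le.trans (add_le_add_left ?_ _)
  refine ENNReal.ofReal_add_le.trans ?_
  rw [add_assoc]
  refine add_le_add_right (hchange.trans ?_) _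
  gcongr
  exact le_add_of_nonneg_right (Real.sqrt_nonneg _)

theorem regressionUtilityBound_le (h : IsRegressionFunction PXY F μ)
    (ht : IsRegressionFunction PXYt F μhat) (hf : f ∈ F) (M : ℝ≥0∞) :
    regressionUtilityBound PXY PXYt μ μhat μhat f μ μhat M
      ≤ ENNReal.ofReal (13 * excessRisk PXY.fst μ μhat)
        + ENNReal.ofReal (excessRisk PXYt.fst μhat f)
        + 2 * M * chiSqDiv PXY.fst PXYt.fst ^ (1 / 2 : ℝ)
            * ENNReal.ofReal (√(excessRisk PXYt.fst μhat f) + √(excessRisk PXYt.fst μhat μ))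
        + ENNReal.ofReal (2 * √(2 * excessRisk PXY.fst μhat f) * √(excessRisk PXY.fst μ μhat)) := by
  have hreal : excessRisk PXY.fst μ μhat
        + 2 * (√(excessRisk PXY.fst μ f) + 2 * √(excessRisk PXY.fst μ μhat))
          * √(excessRisk PXY.fst μ μhat) + 4 * excessRisk PXY.fst μ μhat
      ≤ 13 * excessRisk PXY.fst μ μhat
        + 2 * √(2 * excessRisk PXY.fst μhat f) * √(excessRisk PXY.fst μ μhat) := by
    have hsqrt : √(excessRisk PXY.fst μhat f) ≤ √(2 * excessRisk PXY.fst μhat f) :=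
      Real.sqrt_le_sqrt (le_mul_of_one_le_left (excessRisk_nonneg _ _ _) one_le_two)
    have := sq_add_two_mul_add_four_mul_sq_le (Real.sqrt_nonneg _)
      ((h.sqrt_excessRisk_le_add hf ht.mem).trans (add_le_add_right hsqrt _))
    simpa only [Real.sq_sqrt (excessRisk_nonneg _ _ _)] using this
  have hμ := excessRisk_nonneg PXY.fst μ μhat
  have hENN := ENNReal.ofReal_le_ofReal hreal
  rw [ENNReal.ofReal_add (by positivity) (by positivity),
    ENNReal.ofReal_add hμ (by positivity),
    ENNReal.ofReal_add (by positivity) (by positivity)] at hENN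
  rw [h.regressionUtilityBound_eq ht hf, mul_right_comm (2 * M)]
  have hsum := add_le_add_left hENN (ENNReal.ofReal (excessRisk PXYt.fst μhat f)
    + 2 * M * chiSqDiv PXY.fst PXYt.fst ^ (1 / 2 : ℝ)
        * ENNReal.ofReal (√(excessRisk PXYt.fst μhat f) + √(excessRisk PXYt.fst μhat μ)))
  convert hsum using 1 <;> abel

end IsRegressionFunction

end WellSpecified

section LeastSquares

variable {n m p : ℕ}

lemma quadTrace_eq_dotProduct (e : Fin n → ℝ) (Q : Matrix (Fin n) (Fin p) ℝ) (lam : Fin p → ℝ) :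
    quadTrace e Q lam = (Qᵀ *ᵥ e) ⬝ᵥ (Matrix.diagonal lam *ᵥ (Qᵀ *ᵥ e)) := by
  rw [quadTrace, Matrix.mul_assoc, Matrix.mul_assoc, Matrix.vecMulVec_mul, Matrix.trace_vecMulVec,
    dotProduct_comm, ← Matrix.dotProduct_mulVec, ← Matrix.mulVec_mulVec, Matrix.dotProduct_mulVec,
    ← Matrix.mulVec_mulVec, Matrix.mulVec_transpose]

lemma ols_eq_qMat_transpose_mulVec (A : Matrix (Fin n) (Fin p) ℝ) (Y : Fin n → ℝ) :
    ols A Y = (qMat A)ᵀ *ᵥ Y := by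
  rw [ols, qMat, Matrix.transpose_mul, Matrix.transpose_nonsing_inv, Matrix.transpose_mul,
    Matrix.transpose_transpose]

lemma ols_responses {x : ℕ → Fin p → ℝ} (h : IsUnit ((design n x)ᵀ * design n x)) (β : Fin p → ℝ)
    (e : ℕ → ℝ) :
    ols (design n x) (responses n β x e) = β + (qMat (design n x))ᵀ *ᵥ noise n e := by
  have hdet := (Matrix.isUnit_iff_isUnit_det _).1 h
  rw [← ols_eq_qMat_transpose_mulVec, ols, ols, responses, Matrix.mulVec_add, Matrix.mulVec_mulVec,
    Matrix.mul_assoc, Matrix.nonsing_inv_mul _ hdet, Matrix.one_mulVec]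

variable {S : Set (Fin p → ℝ)} {z : Fin p → ℝ}

lemma ofReal_abs_lin_ols_le_supBound (hz : z ∈ S) (A : Matrix (Fin n) (Fin p) ℝ) (Y : Fin n → ℝ)
    (At : Matrix (Fin m) (Fin p) ℝ) (Yt : Fin m → ℝ) :
    ENNReal.ofReal |lin (ols A Y) z| ≤ supBound S (qMat A) Y (qMat At) Yt ∧
      ENNReal.ofReal |lin (ols At Yt) z| ≤ supBound S (qMat A) Y (qMat At) Yt := by
  rw [ols_eq_qMat_transpose_mulVec, ols_eq_qMat_transpose_mulVec]
  exact ⟨le_max_of_le_left (le_iSup₂_of_le z hz le_rfl),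
    le_max_of_le_right (le_iSup₂_of_le z hz le_rfl)⟩

end LeastSquares

section SecondMoments

variable {p : ℕ} {ν : Measure ((Fin p → ℝ) × ℝ)} {V : Matrix (Fin p) (Fin p) ℝ}

/-- `ν` is the law of a pair (feature vector, noise) with finite second moments, such that `V` is
the second moment matrix of the features and the noise is orthogonal to every feature. -/
structure HasSecondMoments (ν : Measure ((Fin p → ℝ) × ℝ)) (V : Matrix (Fin p) (Fin p) ℝ) :
    Prop where
  memLp_feature : ∀ i, MemLp (fun q => q.1 i) 2 ν
  memLp_noise : MemLp (fun q => q.2) 2 ν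
  integral_feature_mul : ∀ i j, ∫ q, q.1 i * q.1 j ∂ν = V i j
  integral_feature_mul_noise : ∀ i, ∫ q, q.1 i * q.2 ∂ν = 0

section FeatureNoiseLaw

variable {lam : Fin p → ℝ} {σ : ℝ}

lemma IsFeatureNoiseLaw.integral_feature_mul (h : IsFeatureNoiseLaw ν lam σ) (i j : Fin p) :
    ∫ q, q.1 i * q.1 j ∂ν = Matrix.diagonal lam i j := by
  obtain rfl | hij := eq_or_ne i j
  · rw [Matrix.diagonal_apply_eq, ← h.var_feature i,
      variance_of_integral_eq_zero (h.memLp_feature i).1.aemeasurable (h.mean_feature i)]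
    simp only [sq]
  · rw [Matrix.diagonal_apply_ne _ hij, (h.indep_feature i j hij).integral_fun_mul_eq_mul_integral
      (h.memLp_feature i).1 (h.memLp_feature j).1, h.mean_feature, zero_mul]

lemma IsFeatureNoiseLaw.integral_feature_mul_noise [IsFiniteMeasure ν]
    (h : IsFeatureNoiseLaw ν lam σ) (i : Fin p) : ∫ q, q.1 i * q.2 ∂ν = 0 := by
  set 𝓕 : MeasurableSpace ((Fin p → ℝ) × ℝ) := MeasurableSpace.comap Prod.fst inferInstance
  have hmeas : StronglyMeasurable[𝓕] fun q : (Fin p → ℝ) × ℝ => q.1 i :=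
    ((measurable_pi_apply i).comp (comap_measurable Prod.fst)).stronglyMeasurable
  have hpull : ν[fun q => q.1 i * q.2 | 𝓕] =ᵐ[ν] fun q => q.1 i * ν[fun q => q.2 | 𝓕] q :=
    condExp_mul_of_stronglyMeasurable_left hmeas
      ((h.memLp_feature i).integrable_mul h.memLp_noise) (h.memLp_noise.integrable one_le_two)
  rw [← integral_condExp measurable_fst.comap_le]
  refine integral_eq_zero_of_ae ?_
  filter_upwards [hpull, h.condMean_noise] with q hq hq0
  rw [hq, hq0, mul_zero, Pi.zero_apply]

lemma IsFeatureNoiseLaw.hasSecondMoments [IsFiniteMeasure ν] (h : IsFeatureNoiseLaw ν lam σ) :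
    HasSecondMoments ν (Matrix.diagonal lam) :=
  ⟨h.memLp_feature, h.memLp_noise, h.integral_feature_mul, h.integral_feature_mul_noise⟩

end FeatureNoiseLaw

lemma lin_sub (β γ z : Fin p → ℝ) : lin (β - γ) z = lin β z - lin γ z :=
  dotProduct_sub z β γ

lemma measurable_lin (β : Fin p → ℝ) : Measurable (lin β) := by
  unfold lin dotProduct
  fun_prop

lemma measurable_response (β : Fin p → ℝ) :
    Measurable fun q : (Fin p → ℝ) × ℝ => (q.1, lin β q.1 + q.2) :=
  measurable_fst.prodMk (((measurable_lin β).comp measurable_fst).add measurable_snd)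

instance [IsFiniteMeasure ν] (β : Fin p → ℝ) : IsFiniteMeasure (responseLaw β ν) :=
  Measure.isFiniteMeasure_map ν _

lemma responseLaw_fst (β : Fin p → ℝ) : (responseLaw β ν).fst = ν.fst :=
  Measure.map_map measurable_fst (measurable_response β)

namespace HasSecondMoments

variable (h : HasSecondMoments ν V)
include h

lemma memLp_lin (v : Fin p → ℝ) : MemLp (fun q => lin v q.1) 2 ν :=
  memLp_finsetSum Finset.univ fun i _ => (h.memLp_feature i).mul_const (v i)

lemma memLp_lin_fst (v : Fin p → ℝ) : MemLp (lin v) 2 ν.fst :=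
  (memLp_map_measure_iff (measurable_lin v).aestronglyMeasurable measurable_fst.aemeasurable).2
    (h.memLp_lin v)

lemma integral_lin_sq (v : Fin p → ℝ) : ∫ q, lin v q.1 ^ 2 ∂ν = v ⬝ᵥ (V *ᵥ v) := by
  have hexp (q : (Fin p → ℝ) × ℝ) :
      lin v q.1 ^ 2 = ∑ j, ∑ i, v i * (q.1 i * q.1 j) * v j := by
    simp only [lin, dotProduct, sq, Finset.sum_mul_sum]
    exact Finset.sum_congr rfl fun j _ => Finset.sum_congr rfl fun i _ => by ring
  have hint (i j : Fin p) : Integrable (fun q => v i * (q.1 i * q.1 j) * v j) ν :=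
    (((h.memLp_feature i).integrable_mul (h.memLp_feature j)).const_mul _).mul_const _
  simp only [hexp, Matrix.dot_mulVec_eq_sum_sum]
  rw [integral_finsetSum _ fun j _ => integrable_finsetSum _ fun i _ => hint i j]
  refine Finset.sum_congr rfl fun j _ => ?_
  rw [integral_finsetSum _ fun i _ => hint i j]
  simp only [integral_mul_const, integral_const_mul, h.integral_feature_mul]

lemma integral_lin_mul_noise (v : Fin p → ℝ) : ∫ q, lin v q.1 * q.2 ∂ν = 0 := by
  have hint (i : Fin p) : Integrable (fun q => q.1 i * v i * q.2) ν :=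
    ((h.memLp_feature i).mul_const (v i)).integrable_mul h.memLp_noise
  simp only [lin, dotProduct, Finset.sum_mul]
  rw [integral_finsetSum _ fun i _ => hint i]
  simp only [mul_right_comm, integral_mul_const, h.integral_feature_mul_noise, zero_mul,
    Finset.sum_const_zero]

lemma excessRisk_lin (β γ : Fin p → ℝ) :
    excessRisk ν.fst (lin β) (lin γ) = (γ - β) ⬝ᵥ (V *ᵥ (γ - β)) := by
  simp only [excessRisk, ← lin_sub, ← h.integral_lin_sq]
  exact integral_map measurable_fst.aemeasurable
    ((measurable_lin _).pow_const 2).aestronglyMeasurable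

lemma risk_responseLaw_lin (β γ : Fin p → ℝ) :
    risk (responseLaw β ν) (lin γ)
      = excessRisk ν.fst (lin β) (lin γ) + ∫ q, q.2 ^ 2 ∂ν := by
  have hmeas : Measurable fun q : (Fin p → ℝ) × ℝ => (lin γ q.1 - q.2) ^ 2 :=
    (((measurable_lin γ).comp measurable_fst).sub measurable_snd).pow_const 2
  have hexp (q : (Fin p → ℝ) × ℝ) : (lin γ q.1 - (lin β q.1 + q.2)) ^ 2
      = lin (γ - β) q.1 ^ 2 - 2 * (lin (γ - β) q.1 * q.2) + q.2 ^ 2 := by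
    rw [lin_sub]; ring
  have hsq := (h.memLp_lin (γ - β)).integrable_sq
  have hcross : Integrable (fun q => 2 * (lin (γ - β) q.1 * q.2)) ν :=
    ((h.memLp_lin (γ - β)).integrable_mul h.memLp_noise).const_mul 2
  have hdiff : Integrable (fun q => lin (γ - β) q.1 ^ 2 - 2 * (lin (γ - β) q.1 * q.2)) ν :=
    hsq.sub hcross
  rw [risk, responseLaw, integral_map (measurable_response β).aemeasurable
    hmeas.aestronglyMeasurable]
  simp only [hexp]
  rw [integral_add hdiff h.memLp_noise.integrable_sq, integral_sub hsq hcross,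
    integral_const_mul, h.integral_lin_mul_noise, h.integral_lin_sq, h.excessRisk_lin, mul_zero,
    sub_zero]

lemma isRegressionFunction (β : Fin p → ℝ) :
    IsRegressionFunction (responseLaw β ν) (linClass p) (lin β) where
  mem := ⟨β, rfl⟩
  memLp := by
    rintro _ ⟨γ, rfl⟩
    exact responseLaw_fst (ν := ν) β ▸ h.memLp_lin_fst γ
  risk_sub_risk := by
    rintro _ ⟨γ, rfl⟩
    rw [h.risk_responseLaw_lin, h.risk_responseLaw_lin, excessRisk_self, zero_add,
      add_sub_cancel_right, responseLaw_fst]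

lemma continuous_risk_lin (β : Fin p → ℝ) :
    Continuous fun γ => risk (responseLaw β ν) (lin γ) := by
  simp only [h.risk_responseLaw_lin, h.excessRisk_lin, dotProduct, Matrix.mulVec]
  fun_prop

lemma excessRisk_lin_eq_zero_iff (hV : V.PosDef) (β γ : Fin p → ℝ) :
    excessRisk ν.fst (lin β) (lin γ) = 0 ↔ γ = β := by
  rw [h.excessRisk_lin]
  refine ⟨fun h0 => ?_, fun hγ => by simp [hγ]⟩
  by_contra hne
  exact (hV.dotProduct_mulVec_pos (sub_ne_zero.2 hne)).ne' h0

lemma lin_ae_eq_iff (hV : V.PosDef) (β γ : Fin p → ℝ) : lin γ =ᵐ[ν.fst] lin β ↔ γ = β := by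
  rw [← excessRisk_eq_zero_iff (h.memLp_lin_fst γ) (h.memLp_lin_fst β),
    h.excessRisk_lin_eq_zero_iff hV]

lemma eq_lin_of_isOptimal_excessRisk (hV : V.PosDef) {β : Fin p → ℝ} {f : (Fin p → ℝ) → ℝ}
    (hf : IsOptimal (linClass p) (excessRisk ν.fst (lin β)) f) : f = lin β := by
  obtain ⟨⟨γ, rfl⟩, h0⟩ := (isOptimal_excessRisk_iff (Set.mem_range_self β)).1 hf
  rw [(h.excessRisk_lin_eq_zero_iff hV β γ).1 h0]

lemma eq_lin_of_isOptimal_risk (hV : V.PosDef) {β : Fin p → ℝ} {f : (Fin p → ℝ) → ℝ}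
    (hf : IsOptimal (linClass p) (risk (responseLaw β ν)) f) : f = lin β := by
  rw [(h.isRegressionFunction β).isOptimal_risk_iff, responseLaw_fst] at hf
  exact h.eq_lin_of_isOptimal_excessRisk hV hf

lemma posDef {Ω : Type*} [MeasurableSpace Ω] {P : Measure Ω} [NeZero P]
    {x : ℕ → Ω → Fin p → ℝ} {ε : ℕ → Ω → ℝ}
    (hlaw : ∀ i, HasLaw (fun ω => (x i ω, ε i ω)) ν P) {n : ℕ}
    (hinv : ∀ᵐ ω ∂P, IsUnit ((design n (fun i => x i ω))ᵀ * design n (fun i => x i ω))) :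
    V.PosDef := by
  have hsymm : V.IsHermitian := Matrix.IsHermitian.ext fun i j => by
    simp only [star_trivial, ← h.integral_feature_mul, mul_comm]
  refine .of_dotProduct_mulVec_pos hsymm fun v hv => ?_
  rw [star_trivial, ← h.integral_lin_sq]
  refine (integral_nonneg fun _ => sq_nonneg _).lt_of_ne' fun h0 => hv ?_
  rw [integral_eq_zero_iff_of_nonneg (fun _ => sq_nonneg _) (h.memLp_lin v).integrable_sq] at h0
  have hx : ∀ᵐ ω ∂P, ∀ i, lin v (x i ω) = 0 := ae_all_iff.2 fun i =>
    ae_of_ae_map (p := fun q => lin v q.1 = 0) (hlaw i).aemeasurable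
      ((hlaw i).map_eq ▸ h0.mono fun q hq => sq_eq_zero_iff.1 hq)
  obtain ⟨ω, hω, hunit⟩ := (hx.and hinv).exists
  have hdesign : design n (fun i => x i ω) *ᵥ v = 0 := funext fun i => hω i
  refine Matrix.mulVec_injective_of_isUnit hunit ?_
  rw [← Matrix.mulVec_mulVec, hdesign, Matrix.mulVec_zero, Matrix.mulVec_zero]

end HasSecondMoments

end SecondMoments

section UtilityBound

variable {n m p : ℕ} {ν νt : Measure ((Fin p → ℝ) × ℝ)} {lam lamt : Fin p → ℝ}
  {V Vt : Matrix (Fin p) (Fin p) ℝ} {βs βhat βt : Fin p → ℝ}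

lemma HasSecondMoments.excessRisk_lin_add (h : HasSecondMoments ν (Matrix.diagonal lam))
    (β : Fin p → ℝ) (e : Fin n → ℝ) (Q : Matrix (Fin n) (Fin p) ℝ) :
    excessRisk ν.fst (lin β) (lin (β + Qᵀ *ᵥ e)) = quadTrace e Q lam := by
  rw [h.excessRisk_lin, add_sub_cancel_left, quadTrace_eq_dotProduct]

theorem ofReal_utility_lin_le_regressionUtilityBound [IsFiniteMeasure ν] [IsFiniteMeasure νt]
    (h : HasSecondMoments ν V) (ht : HasSecondMoments νt Vt) (hVt : Vt.PosDef) {M : ℝ≥0∞}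
    (hM : ∀ᵐ z ∂ν.fst, ENNReal.ofReal |lin βhat z| ≤ M ∧ ENNReal.ofReal |lin βt z| ≤ M) :
    ENNReal.ofReal (utility (responseLaw βs ν) (lin βt) (lin βhat))
      ≤ regressionUtilityBound (responseLaw βs ν) (responseLaw βhat νt) (lin βs) (lin βhat)
          (lin βhat) (lin βt) (lin βs) (lin βhat) M := by
  refine (h.isRegressionFunction βs).ofReal_utility_le_regressionUtilityBound
    (ht.isRegressionFunction βhat) (Set.mem_range_self βt) (fun heq => ?_)
    (by rwa [responseLaw_fst])
  rw [responseLaw_fst, ht.lin_ae_eq_iff hVt] at heq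
  rw [heq]

theorem regressionUtilityBound_le_traceBound (h : HasSecondMoments ν (Matrix.diagonal lam))
    (ht : HasSecondMoments νt (Matrix.diagonal lamt)) {e : Fin n → ℝ} {et : Fin m → ℝ}
    {Q : Matrix (Fin n) (Fin p) ℝ} {Qt : Matrix (Fin m) (Fin p) ℝ}
    (hβhat : βhat = βs + Qᵀ *ᵥ e) (hβt : βt = βhat + Qtᵀ *ᵥ et) (M : ℝ≥0∞) :
    regressionUtilityBound (responseLaw βs ν) (responseLaw βhat νt) (lin βs) (lin βhat)
        (lin βhat) (lin βt) (lin βs) (lin βhat) M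
      ≤ traceBound e Q et Qt lam lamt (chiSqDiv ν.fst νt.fst) M := by
  have hle := (h.isRegressionFunction βs).regressionUtilityBound_le (ht.isRegressionFunction βhat)
    (Set.mem_range_self βt) M
  rw [responseLaw_fst, responseLaw_fst, excessRisk_comm νt.fst (lin βhat) (lin βs)] at hle
  subst hβt
  rw [h.excessRisk_lin_add, ht.excessRisk_lin_add] at hle
  subst hβhat
  rwa [h.excessRisk_lin_add, ht.excessRisk_lin_add] at hle

end UtilityBound

section Measurability

variable {Ω : Type*} [MeasurableSpace Ω] {P : Measure Ω} {n p : ℕ}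

lemma aestronglyMeasurable_mulVec {A : Ω → Matrix (Fin n) (Fin p) ℝ} {v : Ω → Fin p → ℝ}
    (hA : AEStronglyMeasurable A P) (hv : AEStronglyMeasurable v P) :
    AEStronglyMeasurable (fun ω => A ω *ᵥ v ω) P :=
  (continuous_fst.matrix_mulVec continuous_snd).comp_aestronglyMeasurable (hA.prodMk hv)

lemma aestronglyMeasurable_nonsing_inv {A : Ω → Matrix (Fin p) (Fin p) ℝ}
    (hA : AEStronglyMeasurable A P) : AEStronglyMeasurable (fun ω => (A ω)⁻¹) P := by
  simp only [Matrix.inv_def, Ring.inverse_eq_inv']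
  exact (continuous_id.matrix_det.comp_aestronglyMeasurable hA).inv₀.smul
    (continuous_id.matrix_adjugate.comp_aestronglyMeasurable hA)

lemma aestronglyMeasurable_ols {A : Ω → Matrix (Fin n) (Fin p) ℝ} {Y : Ω → Fin n → ℝ}
    (hA : AEStronglyMeasurable A P) (hY : AEStronglyMeasurable Y P) :
    AEStronglyMeasurable (fun ω => ols (A ω) (Y ω)) P := by
  have htrans : AEStronglyMeasurable (fun ω => (A ω)ᵀ) P :=
    continuous_id.matrix_transpose.comp_aestronglyMeasurable hA
  have hgram : Continuous fun B : Matrix (Fin n) (Fin p) ℝ => Bᵀ * B :=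
    continuous_id.matrix_transpose.matrix_mul continuous_id
  simp only [ols, ← Matrix.mulVec_mulVec]
  exact aestronglyMeasurable_mulVec
    (aestronglyMeasurable_nonsing_inv (hgram.comp_aestronglyMeasurable hA))
    (aestronglyMeasurable_mulVec htrans hY)

lemma aestronglyMeasurable_ols_responses {x : ℕ → Ω → Fin p → ℝ} {ε : ℕ → Ω → ℝ}
    (hmeas : ∀ i, AEMeasurable (fun ω => (x i ω, ε i ω)) P) {β : Ω → Fin p → ℝ}
    (hβ : AEStronglyMeasurable β P) (n : ℕ) :
    AEStronglyMeasurable (fun ω => ols (design n fun i => x i ω)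
      (responses n (β ω) (fun i => x i ω) fun i => ε i ω)) P := by
  have hx : AEStronglyMeasurable (fun ω => design n fun i => x i ω) P :=
    (aemeasurable_pi_lambda _ fun i : Fin n => (hmeas i).fst).aestronglyMeasurable
  have hε : AEStronglyMeasurable (fun ω => noise n fun i => ε i ω) P :=
    (aemeasurable_pi_lambda _ fun i : Fin n => (hmeas i).snd).aestronglyMeasurable
  exact aestronglyMeasurable_ols hx ((aestronglyMeasurable_mulVec hx hβ).add hε)

end Measurability

section Consistency

variable {Ω : Type*} [MeasurableSpace Ω] {P : Measure Ω} {p : ℕ}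
  {ν νt : Measure ((Fin p → ℝ) × ℝ)} {V Vt : Matrix (Fin p) (Fin p) ℝ}

lemma ae_tendsto_average {E : Type*} [MeasurableSpace E] {ρ : Measure E} {Z : ℕ → Ω → E}
    (hlaw : ∀ i, HasLaw (Z i) ρ P) (hind : Pairwise fun i j => Z i ⟂ᵢ[P] Z j) {φ : E → ℝ}
    (hφ : Measurable φ) (hint : Integrable φ ρ) :
    ∀ᵐ ω ∂P, Tendsto (fun m : ℕ => (m : ℝ)⁻¹ * ∑ k : Fin m, φ (Z k ω)) atTop
      (𝓝 (∫ q, φ q ∂ρ)) := by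
  have hident (i : ℕ) : IdentDistrib (Z i) (Z 0) P P :=
    ⟨(hlaw i).aemeasurable, (hlaw 0).aemeasurable, (hlaw i).map_eq.trans (hlaw 0).map_eq.symm⟩
  rw [← (hlaw 0).map_eq] at hint
  have hslln := strong_law_ae_real (fun k ω => φ (Z k ω))
    (hint.comp_aemeasurable (hlaw 0).aemeasurable) (fun i j hij => (hind hij).comp hφ hφ)
    fun i => (hident i).comp hφ
  rw [← (hlaw 0).integral_comp hφ.aestronglyMeasurable]
  filter_upwards [hslln] with ω hω
  exact hω.congr fun m => by rw [div_eq_inv_mul, Finset.sum_range]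

lemma ols_eq_inv_smul_mulVec_smul {m : ℕ} {c : ℝ} (hc : c ≠ 0) {A : Matrix (Fin m) (Fin p) ℝ}
    (h : IsUnit (Aᵀ * A).det) (Y : Fin m → ℝ) :
    ols A Y = (c • (Aᵀ * A))⁻¹ *ᵥ (c • (Aᵀ *ᵥ Y)) := by
  let _ : Invertible c := invertibleOfNonzero hc
  rw [ols, Matrix.inv_smul _ _ h, Matrix.smul_mulVec, Matrix.mulVec_smul, smul_smul,
    invOf_mul_self, one_smul, Matrix.mulVec_mulVec]

lemma tendsto_ols_responses (hV : V.det ≠ 0) {x : ℕ → Fin p → ℝ} {e : ℕ → ℝ}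
    (hgram : Tendsto (fun m : ℕ => (m : ℝ)⁻¹ • ((design m x)ᵀ * design m x)) atTop (𝓝 V))
    (hnoise : Tendsto (fun m : ℕ => (m : ℝ)⁻¹ • ((design m x)ᵀ *ᵥ noise m e)) atTop (𝓝 0))
    (β : Fin p → ℝ) :
    Tendsto (fun m => ols (design m x) (responses m β x e)) atTop (𝓝 β) := by
  have hmulVec : Continuous fun q : Matrix (Fin p) (Fin p) ℝ × (Fin p → ℝ) => q.1 *ᵥ q.2 :=
    continuous_fst.matrix_mulVec continuous_snd
  have hinv : Tendsto (fun m : ℕ => ((m : ℝ)⁻¹ • ((design m x)ᵀ * design m x))⁻¹) atTop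
      (𝓝 V⁻¹) := by
    have hcont : ContinuousAt Inv.inv V := continuousAt_matrix_inv V
      (by simpa only [Ring.inverse_eq_inv'] using continuousAt_inv₀ hV)
    exact hcont.tendsto.comp hgram
  have hresp : Tendsto (fun m : ℕ => (m : ℝ)⁻¹ • ((design m x)ᵀ *ᵥ responses m β x e)) atTop
      (𝓝 (V *ᵥ β)) := by
    have hsum := ((hmulVec.tendsto (V, β)).comp (hgram.prodMk_nhds tendsto_const_nhds)).add hnoise
    rw [add_zero] at hsum
    refine hsum.congr fun m => ?_
    simp only [Function.comp_apply, responses, Matrix.mulVec_add, smul_add, Matrix.smul_mulVec,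
      Matrix.mulVec_mulVec]
  have hlim := (hmulVec.tendsto (V⁻¹, V *ᵥ β)).comp (hinv.prodMk_nhds hresp)
  rw [Matrix.mulVec_mulVec, Matrix.nonsing_inv_mul V hV.isUnit, Matrix.one_mulVec] at hlim
  refine hlim.congr' ?_
  filter_upwards [((continuous_id.matrix_det.tendsto V).comp hgram).eventually_ne hV,
    eventually_ne_atTop 0] with m hdet hm
  simp only [Function.comp_apply, id_eq, Matrix.det_smul] at hdet
  exact (ols_eq_inv_smul_mulVec_smul (inv_ne_zero (Nat.cast_ne_zero.2 hm))
    (right_ne_zero_of_mul hdet).isUnit _).symm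

theorem HasSecondMoments.ae_tendsto_ols_responses (h : HasSecondMoments ν V) (hV : V.det ≠ 0)
    {x : ℕ → Ω → Fin p → ℝ} {ε : ℕ → Ω → ℝ} (hlaw : ∀ i, HasLaw (fun ω => (x i ω, ε i ω)) ν P)
    (hind : Pairwise fun i j => (fun ω => (x i ω, ε i ω)) ⟂ᵢ[P] fun ω => (x j ω, ε j ω)) :
    ∀ᵐ ω ∂P, ∀ β, Tendsto (fun m => ols (design m fun i => x i ω)
      (responses m β (fun i => x i ω) fun i => ε i ω)) atTop (𝓝 β) := by
  have hgram : ∀ᵐ ω ∂P, ∀ i j, Tendsto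
      (fun m : ℕ => (m : ℝ)⁻¹ * ∑ k : Fin m, x k ω i * x k ω j) atTop (𝓝 (V i j)) := by
    simp only [ae_all_iff, ← h.integral_feature_mul]
    exact fun i j => ae_tendsto_average hlaw hind (φ := fun q => q.1 i * q.1 j) (by fun_prop)
      ((h.memLp_feature i).integrable_mul (h.memLp_feature j))
  have hnoise : ∀ᵐ ω ∂P, ∀ i, Tendsto
      (fun m : ℕ => (m : ℝ)⁻¹ * ∑ k : Fin m, x k ω i * ε k ω) atTop (𝓝 0) := by
    refine ae_all_iff.2 fun i => ?_
    rw [← h.integral_feature_mul_noise i]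
    exact ae_tendsto_average hlaw hind (φ := fun q => q.1 i * q.2) (by fun_prop)
      ((h.memLp_feature i).integrable_mul h.memLp_noise)
  filter_upwards [hgram, hnoise] with ω hgramω hnoiseω
  exact tendsto_ols_responses hV
    (tendsto_pi_nhds.2 fun i => tendsto_pi_nhds.2 fun j => hgramω i j)
    (tendsto_pi_nhds.2 fun i => hnoiseω i)

theorem tendsto_measure_utility_gt [IsFiniteMeasure P] (h : HasSecondMoments ν V)
    (ht : HasSecondMoments νt Vt) (hVt : Vt.det ≠ 0) (βs : Fin p → ℝ) {β : Ω → Fin p → ℝ}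
    (hβ : AEStronglyMeasurable β P) {x : ℕ → Ω → Fin p → ℝ} {ε : ℕ → Ω → ℝ}
    (hlaw : ∀ i, HasLaw (fun ω => (x i ω, ε i ω)) νt P)
    (hind : Pairwise fun i j => (fun ω => (x i ω, ε i ω)) ⟂ᵢ[P] fun ω => (x j ω, ε j ω))
    {δ : ℝ} (hδ : 0 < δ) :
    Tendsto (fun m => P {ω | δ < utility (responseLaw βs ν)
        (lin (ols (design m fun i => x i ω) (responses m (β ω) (fun i => x i ω) fun i => ε i ω)))
        (lin (β ω))})
      atTop (𝓝 0) := by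
  have hcont := h.continuous_risk_lin βs
  have hmeas (m : ℕ) : AEStronglyMeasurable (fun ω => risk (responseLaw βs ν)
      (lin (ols (design m fun i => x i ω)
        (responses m (β ω) (fun i => x i ω) fun i => ε i ω)))) P :=
    hcont.comp_aestronglyMeasurable
      (aestronglyMeasurable_ols_responses (fun i => (hlaw i).aemeasurable) hβ m)
  have hlim := (ht.ae_tendsto_ols_responses hVt hlaw hind).mono fun ω hω =>
    (hcont.tendsto (β ω)).comp (hω (β ω))
  have hmeasure := tendstoInMeasure_iff_dist.1 (tendstoInMeasure_of_tendsto_ae hmeas hlim) δ hδ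
  exact tendsto_of_tendsto_of_tendsto_of_le_of_le tendsto_const_nhds hmeasure
    (fun _ => zero_le) fun _ => measure_mono fun ω (hω : δ < utility _ _ _) => hω.le

end Consistency

end SyntheticLR

open SyntheticLR in
theorem theorem3_general {Ω : Type*} [MeasurableSpace Ω] (P : Measure Ω) [IsProbabilityMeasure P]
    {p : ℕ} (ν νt : Measure ((Fin p → ℝ) × ℝ))
    (lam lamt : Fin p → ℝ) (hν : HasSecondMoments ν (Matrix.diagonal lam))
    (hνt : HasSecondMoments νt (Matrix.diagonal lamt)) (βs : Fin p → ℝ)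
    (x : ℕ → Ω → Fin p → ℝ) (ε : ℕ → Ω → ℝ) (xt : ℕ → Ω → Fin p → ℝ) (εt : ℕ → Ω → ℝ)
    (hlaw : ∀ i, HasLaw (fun ω => (x i ω, ε i ω)) ν P)
    (hlawt : ∀ i, HasLaw (fun ω => (xt i ω, εt i ω)) νt P)
    (hindt : Pairwise fun i j => (fun ω => (xt i ω, εt i ω)) ⟂ᵢ[P] fun ω => (xt j ω, εt j ω))
    (n₀ m₀ : ℕ)
    (hinv : ∀ n ≥ n₀, ∀ᵐ ω ∂P,
      IsUnit ((design n (fun i => x i ω))ᵀ * design n (fun i => x i ω)))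
    (hinvt : ∀ m ≥ m₀, ∀ᵐ ω ∂P,
      IsUnit ((design m (fun i => xt i ω))ᵀ * design m (fun i => xt i ω)))
    (S : Set (Fin p → ℝ)) (hS : ∀ᵐ z ∂ν.fst, z ∈ S) :
    (∀ n ≥ n₀, ∀ m ≥ m₀, ∀ᵐ ω ∂P,
      let X := fun i => x i ω
      let e := fun i => ε i ω
      let Xt := fun i => xt i ω
      let et := fun i => εt i ω
      let βhat := betaHat n βs X e
      let fhat := lin βhat
      let ft := lin (betaTilde n m βs X e Xt et)
      let PXY := responseLaw βs ν
      let PXYt := responseLaw βhat νt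
      let Q := qMat (design n X)
      let Qt := qMat (design m Xt)
      let M := supBound S Q (responses n βs X e) Qt (responses m βhat Xt et)
      let B := traceBound (noise n e) Q (noise m et) Qt lam lamt (chiSqDiv ν.fst νt.fst) M
      ENNReal.ofReal (utility PXY ft fhat) ≤ B ∧
      ∀ fs fts, IsOptimal (linClass p) (risk PXY) fs →
        IsOptimal (linClass p) (excessRisk νt.fst fhat) fts →
        ENNReal.ofReal (utility PXY ft fhat)
            ≤ regressionUtilityBound PXY PXYt (lin βs) fhat fhat ft fs fts M ∧
          regressionUtilityBound PXY PXYt (lin βs) fhat fhat ft fs fts M ≤ B) ∧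
    ∀ n, ∀ δ : ℝ, 0 < δ → Tendsto (fun m => P {ω |
        δ < utility (responseLaw βs ν)
          (lin (betaTilde n m βs (fun i => x i ω) (fun i => ε i ω)
            (fun i => xt i ω) (fun i => εt i ω)))
          (lin (betaHat n βs (fun i => x i ω) (fun i => ε i ω)))})
      atTop (𝓝 0) := by
  have hνprob : IsProbabilityMeasure ν := (hlaw 0).isProbabilityMeasure_iff.1 inferInstance
  have hνtprob : IsProbabilityMeasure νt := (hlawt 0).isProbabilityMeasure_iff.1 inferInstance
  have hΛ := hν.posDef hlaw (hinv n₀ le_rfl)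
  have hΛt := hνt.posDef hlawt (hinvt m₀ le_rfl)
  refine ⟨fun n hn m hm => ?_, fun n δ hδ => ?_⟩
  · filter_upwards [hinv n hn, hinvt m hm] with ω hu hut
    intro X e Xt et βhat fhat ft PXY PXYt Q Qt M B
    have hutility := ofReal_utility_lin_le_regressionUtilityBound (βs := βs) hν hνt hΛt
      (hS.mono fun z hz => ofReal_abs_lin_ols_le_supBound hz (design n X) (responses n βs X e)
        (design m Xt) (responses m βhat Xt et))
    have htrace := regressionUtilityBound_le_traceBound hν hνt (ols_responses hu βs e)
      (ols_responses hut βhat et) M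
    refine ⟨hutility.trans htrace, fun fs fts hfs hfts => ?_⟩
    obtain rfl := hν.eq_lin_of_isOptimal_risk hΛ hfs
    obtain rfl := hνt.eq_lin_of_isOptimal_excessRisk hΛt hfts
    exact ⟨hutility, htrace⟩
  · exact tendsto_measure_utility_gt hν hνt hΛt.det_pos.ne' βs
      (aestronglyMeasurable_ols_responses (fun i => (hlaw i).aemeasurable)
        aestronglyMeasurable_const n) hlawt hindt hδ

open SyntheticLR in
theorem theorem3 {Ω : Type*} [MeasurableSpace Ω] (P : Measure Ω) [IsProbabilityMeasure P]
    {p : ℕ}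
    -- laws of (feature, noise) for the original and the synthetic data
    (ν νt : Measure ((Fin p → ℝ) × ℝ)) [IsProbabilityMeasure ν] [IsProbabilityMeasure νt]
    (lam lamt : Fin p → ℝ) (σ σt : ℝ)
    (hν : IsFeatureNoiseLaw ν lam σ) (hνt : IsFeatureNoiseLaw νt lamt σt)
    (hbdd : ∃ C : ℝ, ∀ᵐ q ∂νt, |q.2| ≤ C)
    (hχ : chiSqDiv ν.fst νt.fst < ⊤)
    (βs : Fin p → ℝ)
    -- the original and the synthetic samples: i.i.d., and independent of each other
    (x : ℕ → Ω → Fin p → ℝ) (ε : ℕ → Ω → ℝ) (xt : ℕ → Ω → Fin p → ℝ) (εt : ℕ → Ω → ℝ)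
    (hlaw : ∀ i, HasLaw (fun ω => (x i ω, ε i ω)) ν P)
    (hlawt : ∀ i, HasLaw (fun ω => (xt i ω, εt i ω)) νt P)
    (hind : iIndepFun (fun i ω => (x i ω, ε i ω)) P)
    (hindt : iIndepFun (fun i ω => (xt i ω, εt i ω)) P)
    (hcross : IndepFun (fun ω i => (x i ω, ε i ω)) (fun ω i => (xt i ω, εt i ω)) P)
    -- almost sure invertibility, which can only hold from some sample size on
    (n₀ m₀ : ℕ)
    (hinv : ∀ n ≥ n₀, ∀ᵐ ω ∂P,
      IsUnit ((design n (fun i => x i ω))ᵀ * design n (fun i => x i ω)))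
    (hinvt : ∀ m ≥ m₀, ∀ᵐ ω ∂P,
      IsUnit ((design m (fun i => xt i ω))ᵀ * design m (fun i => xt i ω)))
    -- the feature domain
    (S : Set (Fin p → ℝ)) (hS : ∀ᵐ z ∂ν.fst, z ∈ S) :
    (∀ n ≥ n₀, ∀ m ≥ m₀, ∀ᵐ ω ∂P,
      let X := fun i => x i ω
      let e := fun i => ε i ω
      let Xt := fun i => xt i ω
      let et := fun i => εt i ω
      let βhat := betaHat n βs X e
      let fhat := lin βhat
      let ft := lin (betaTilde n m βs X e Xt et)
      let PXY := responseLaw βs ν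
      let PXYt := responseLaw βhat νt
      let Q := qMat (design n X)
      let Qt := qMat (design m Xt)
      let M := supBound S Q (responses n βs X e) Qt (responses m βhat Xt et)
      let B := traceBound (noise n e) Q (noise m et) Qt lam lamt (chiSqDiv ν.fst νt.fst) M
      ENNReal.ofReal (utility PXY ft fhat) ≤ B ∧
      -- this is what the general bound becomes
      ∀ fs fts, IsOptimal (linClass p) (risk PXY) fs →
        IsOptimal (linClass p) (excessRisk νt.fst fhat) fts →
        ENNReal.ofReal (utility PXY ft fhat)
            ≤ regressionUtilityBound PXY PXYt (lin βs) fhat fhat ft fs fts M ∧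
          regressionUtilityBound PXY PXYt (lin βs) fhat fhat ft fs fts M ≤ B) ∧
    ∀ δ : ℝ, 0 < δ → ∃ L : ℕ → ℝ≥0∞,
      (∀ n ≥ n₀, Tendsto (fun m => P {ω |
          δ < utility (responseLaw βs ν)
            (lin (betaTilde n m βs (fun i => x i ω) (fun i => ε i ω)
              (fun i => xt i ω) (fun i => εt i ω)))
            (lin (betaHat n βs (fun i => x i ω) (fun i => ε i ω)))})
        atTop (𝓝 (L n))) ∧
      Tendsto L atTop (𝓝 0) := by
  obtain ⟨hbound, hlim⟩ := theorem3_general P ν νt lam lamt hν.hasSecondMoments hνt.hasSecondMoments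
    βs x ε xt εt hlaw hlawt (fun _ _ hij => hindt.indepFun hij) n₀ m₀ hinv hinvt S hS
  exact ⟨hbound, fun δ hδ => ⟨0, fun n _ => hlim n δ hδ, tendsto_const_nhds⟩⟩
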